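/- Let $\mathrm{Sk}_{2k}$ be the space of complex skew-symmetric $2k\times 2k$ matrices, and put $N=\dim\mathrm{Sk}_{2k}=k(2k-1)$. Two germs at $0$ of holomorphic maps $M_1,M_2:(\mathbb C^s,0)\to \mathrm{Sk}_{2k}$ (with arbitrary values at $0$) are called $\mathrm{Sk}$-equivalent if $M_1\circ\varphi=A^{\top}M_2A$ for some germ $\varphi:(\mathbb C^s,0)\to(\mathbb C^s,0)$ of a biholomorphism and some germ at $0$ of a holomorphic map $A:\mathbb C^s\to \mathrm{GL}_{2k}(\mathbb C)$. A germ $M$ is called $\mathrm{Sk}$-simple if, for some $l$, the $l$-jet of $M$ at $0$ has a neighbourhood, in the space of $l$-jets at $0$ of maps $\mathbb C^s\to\mathrm{Sk}_{2k}$ (with arbitrary values at $0$), such that the germs with $l$-jet in this neighbourhood belong to only finitely many $\mathrm{Sk}$-equivalence classes. Let $s\ge 1$ and $k\ge 2$, let $M:(\mathbb C^s,0)\to(\mathrm{Sk}_{2k},0)$ be an $\mathrm{Sk}$-simple holomorphic map germ with $M(0)=0$, and let $r$ be the rank of the derivative of $M$ at $0$. Then at least one of the following holds: a) $s=1$ and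 $r\in\{0,1\}$; b) $k\ge 3$, $s\ge N-1$ and $r\in\{N-1,N\}$; c) $k=3$, $s=2$ and $r\le 2$; d) $k=3$, $r=13$ and $s\ge 13$; e) $k=2$ and $s\ge 2$. -/

import Mathlib

open Filter Topology

/-- The map `M` from `ℂ^s` to square matrices represents a germ at `0` of a holomorphic family of
skew-symmetric matrices (with no condition on the value at `0`). -/
def IsSkewGerm {s n : ℕ} (M : (Fin s → ℂ) → Matrix (Fin n) (Fin n) ℂ) : Prop :=
  (∀ i j, AnalyticAt ℂ (fun x => M x i j) 0) ∧ ∀ᶠ x in 𝓝 (0 : Fin s → ℂ), (M x).transpose = -M x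

/-- `φ` represents a germ at `0` of a biholomorphism `(ℂ^s, 0) → (ℂ^s, 0)`. -/
def IsBiholGerm {s : ℕ} (φ : (Fin s → ℂ) → (Fin s → ℂ)) : Prop :=
  φ 0 = 0 ∧ AnalyticAt ℂ φ 0 ∧
    ∃ ψ : (Fin s → ℂ) → (Fin s → ℂ), ψ 0 = 0 ∧ AnalyticAt ℂ ψ 0 ∧
      (∀ᶠ x in 𝓝 0, ψ (φ x) = x) ∧ (∀ᶠ x in 𝓝 0, φ (ψ x) = x)

/-- Equivalence of germs at `0` of skew-symmetric matrix families: `M₁ ∘ φ = Aᵀ M₂ A` for a germ of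
a biholomorphism `φ` of the source and a germ `A` of a holomorphic family of invertible matrices. -/
def SkEquiv {s n : ℕ} (M₁ M₂ : (Fin s → ℂ) → Matrix (Fin n) (Fin n) ℂ) : Prop :=
  ∃ (φ : (Fin s → ℂ) → (Fin s → ℂ)) (A : (Fin s → ℂ) → Matrix (Fin n) (Fin n) ℂ),
    IsBiholGerm φ ∧ (∀ i j, AnalyticAt ℂ (fun x => A x i j) 0) ∧
      (∀ᶠ x in 𝓝 0, IsUnit (A x)) ∧
      ∀ᶠ x in 𝓝 0, M₁ (φ x) = (A x).transpose * M₂ x * A x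

/-- The `l`-jets at `0` of the matrix families `M` and `M'` are within distance `ε`: all derivatives
at `0` of order at most `l` of corresponding entries differ by less than `ε`. -/
def JetClose {s n : ℕ} (l : ℕ) (ε : ℝ) (M M' : (Fin s → ℂ) → Matrix (Fin n) (Fin n) ℂ) : Prop :=
  ∀ d ≤ l, ∀ i j, ‖iteratedFDeriv ℂ d (fun x => M' x i j) 0 -
    iteratedFDeriv ℂ d (fun x => M x i j) 0‖ < ε

/-- Simplicity (absence of moduli): for some `l` there is a neighbourhood of the `l`-jet of `M` such
that the germs of skew-symmetric families with `l`-jet in this neighbourhood form only finitely many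
equivalence classes. The germs `M'` need not vanish at `0`, so all the germs of small deformations
of `M`, at all points near `0`, are taken into account. -/
def IsSkSimple {s n : ℕ} (M : (Fin s → ℂ) → Matrix (Fin n) (Fin n) ℂ) : Prop :=
  ∃ (l : ℕ) (ε : ℝ) (F : Set ((Fin s → ℂ) → Matrix (Fin n) (Fin n) ℂ)), 0 < ε ∧ F.Finite ∧
    ∀ M' : (Fin s → ℂ) → Matrix (Fin n) (Fin n) ℂ, IsSkewGerm M' → JetClose l ε M M' →
      ∃ M₀ ∈ F, SkEquiv M' M₀

/-- The derivative of a matrix family at `0`, computed entrywise. -/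
noncomputable def derivAtZero {s n : ℕ} (M : (Fin s → ℂ) → Matrix (Fin n) (Fin n) ℂ) :
    (Fin s → ℂ) →ₗ[ℂ] Matrix (Fin n) (Fin n) ℂ where
  toFun v := Matrix.of fun i j => fderiv ℂ (fun x => M x i j) 0 v
  map_add' v w := by ext i j; simp
  map_smul' c v := by ext i j; simp

/-- The rank of a matrix family at `0`: the rank of its derivative there. -/
noncomputable def rankAtZero {s n : ℕ} (M : (Fin s → ℂ) → Matrix (Fin n) (Fin n) ℂ) : ℕ :=
  Module.finrank ℂ (LinearMap.range (derivAtZero M))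

/-!
A simple germ `M` vanishing at `0` stays simple when a small linear term is added to it, and
equivalent germs vanishing at `0` have derivatives whose images are congruent spaces of
skew-symmetric matrices. Hence the images of all linear maps close to the derivative of `M` form
finitely many congruence classes (`IsSkSimple.exists_finite_congruence`). The theorem follows by
exhibiting moduli of spaces of skew-symmetric matrices in all the excluded cases. Write
`N = k (2k - 1)` for the dimension of the space of skew-symmetric matrices of size `2k`.

* For `3 ≤ ρ ≤ N - 3` and `k ≥ 3` the Grassmannian of `ρ`-dimensional spaces has dimension
  `ρ (N - ρ)`, which exceeds the dimension `4k² - 1` of the group acting on it. Finitely many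
  orbits do not fill an open set, because a smooth map does not raise the Hausdorff dimension
  (`hasModuli_of_three_le`).
* For `ρ = 2` and `k ≥ 4` the dimensions do not suffice, since generic pencils have large
  stabilizers. The moduli come from the `k` singular members of a pencil `(A, B)`, that is from the
  eigenvalues of `T = A⁻¹ B` up to projective transformations. The traces of `T, T², T³, T⁴` are
  independent functions near a generic pencil, but on the congruence class of a two-dimensional
  space they take values in a set of dimension at most three (`hasModuli_two`).
* Spaces of dimension `N - 2` are annihilators of pencils with respect to the trace form, so for
  `k ≥ 4` they have moduli too (`not_hasModuli_two_of_isSkSimple`).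

A germ of rank `r` can be deformed to have any rank `ρ` with `r ≤ ρ ≤ min s N`, and for `s ≥ 3` the
choice `ρ = max r 3` brings small ranks into the range of the first case.
-/

/-! ### Coordinates on skew-symmetric matrices -/

/-- The positions above the diagonal of an `n × n` matrix. The entries at these positions are
coordinates on the space of skew-symmetric matrices. -/
abbrev SkewIndex (n : ℕ) : Type := {p : Fin n × Fin n // p.1 < p.2}

/-- The skew-symmetric matrix with prescribed entries above the diagonal. -/
def skewMatrix (n : ℕ) : (SkewIndex n → ℂ) →ₗ[ℂ] Matrix (Fin n) (Fin n) ℂ where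
  toFun c := Matrix.of fun i j =>
    if h : i < j then c ⟨(i, j), h⟩ else if h : j < i then -c ⟨(j, i), h⟩ else 0
  map_add' c d := by
    ext i j
    simp only [Matrix.of_apply, Matrix.add_apply, Pi.add_apply]
    split_ifs <;> ring
  map_smul' a c := by
    ext i j
    simp only [Matrix.of_apply, Matrix.smul_apply, Pi.smul_apply, RingHom.id_apply, smul_eq_mul]
    split_ifs <;> ring

/-- The entries of a matrix above the diagonal. -/
def upperEntries (n : ℕ) : Matrix (Fin n) (Fin n) ℂ →ₗ[ℂ] (SkewIndex n → ℂ) where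
  toFun X p := X p.1.1 p.1.2
  map_add' _ _ := rfl
  map_smul' _ _ := rfl

lemma upperEntries_apply {n : ℕ} (X : Matrix (Fin n) (Fin n) ℂ) (p : SkewIndex n) :
    upperEntries n X p = X p.1.1 p.1.2 := rfl

lemma skewMatrix_apply {n : ℕ} (c : SkewIndex n → ℂ) (i j : Fin n) :
    skewMatrix n c i j =
      if h : i < j then c ⟨(i, j), h⟩ else if h : j < i then -c ⟨(j, i), h⟩ else 0 := rfl

lemma upperEntries_skewMatrix {n : ℕ} (c : SkewIndex n → ℂ) :
    upperEntries n (skewMatrix n c) = c := by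
  ext ⟨⟨i, j⟩, h⟩
  have h' : i < j := h
  simp [upperEntries_apply, skewMatrix_apply, h']

lemma skewMatrix_transpose {n : ℕ} (c : SkewIndex n → ℂ) :
    (skewMatrix n c).transpose = -skewMatrix n c := by
  ext i j
  simp only [Matrix.transpose_apply, Matrix.neg_apply, skewMatrix_apply]
  rcases lt_trichotomy i j with h | h | h
  · simp [h, h.not_gt]
  · simp [h]
  · simp [h, h.not_gt]

lemma skewMatrix_upperEntries {n : ℕ} {X : Matrix (Fin n) (Fin n) ℂ}
    (hX : X.transpose = -X) : skewMatrix n (upperEntries n X) = X := by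
  have hX' : ∀ i j, X j i = -X i j := fun i j => congrFun (congrFun hX i) j
  ext i j
  rw [skewMatrix_apply]
  split_ifs with h₁ h₂
  · rfl
  · rw [upperEntries_apply, hX' i j, neg_neg]
  · obtain rfl : i = j := le_antisymm (not_lt.1 h₂) (not_lt.1 h₁)
    linear_combination -hX' i i / 2

lemma skewMatrix_injective (n : ℕ) : Function.Injective (skewMatrix n) :=
  Function.LeftInverse.injective upperEntries_skewMatrix

/-- The sum over the square of a symmetric function vanishing on the diagonal is twice the sum
over the positions above the diagonal. -/
lemma sum_eq_two_mul_sum_skewIndex {n : ℕ} {R : Type*} [CommRing R] (f : Fin n → Fin n → R)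
    (hsymm : ∀ i j, f j i = f i j) (hdiag : ∀ i, f i i = 0) :
    ∑ i, ∑ j, f i j = 2 * ∑ p : SkewIndex n, f p.1.1 p.1.2 := by
  have hlt : ∑ p : SkewIndex n, f p.1.1 p.1.2
      = ∑ i, ∑ j, if i < j then f i j else 0 := by
    rw [← Fintype.sum_prod_type' (f := fun i j => if i < j then f i j else 0),
      ← Finset.sum_filter]
    exact (Finset.sum_subtype (Finset.univ.filter fun p : Fin n × Fin n => p.1 < p.2)
      (by simp) (fun p => f p.1 p.2)).symm
  have hgt : ∑ i, ∑ j, (if i < j then f i j else 0) = ∑ i, ∑ j, if j < i then f i j else 0 := by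
    rw [Finset.sum_comm]
    simp only [hsymm]
  have hsplit : ∑ i, ∑ j, f i j = ∑ i, ∑ j, (if i < j then f i j else 0)
      + ∑ i, ∑ j, if j < i then f i j else 0 := by
    simp only [← Finset.sum_add_distrib]
    refine Finset.sum_congr rfl fun i _ => Finset.sum_congr rfl fun j _ => ?_
    rcases lt_trichotomy i j with h | h | h
    · simp [h, h.le]
    · simp [h, hdiag]
    · simp [h, h.le]
  rw [hsplit, ← hgt, hlt, two_mul]

lemma card_skewIndex (k : ℕ) : Fintype.card (SkewIndex (2 * k)) = k * (2 * k - 1) := by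
  have h := sum_eq_two_mul_sum_skewIndex (n := 2 * k) (R := ℤ)
    (fun i j => if i = j then 0 else 1) (by simp [eq_comm]) (by simp)
  have h₁ : ∀ i : Fin (2 * k), (∑ j, if i = j then (0 : ℤ) else 1) = 2 * k - 1 := by
    intro i
    have : ∀ j, (if i = j then (0 : ℤ) else 1) = 1 - if i = j then 1 else 0 := by
      intro j; split_ifs <;> rfl
    simp [this]
  have h₂ : ∀ p : SkewIndex (2 * k), (if p.1.1 = p.1.2 then (0 : ℤ) else 1) = 1 :=
    fun p => if_neg p.2.ne
  simp only [h₁, h₂, Finset.sum_const, Finset.card_univ, Fintype.card_fin, nsmul_eq_mul,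
    mul_one] at h
  rcases Nat.eq_zero_or_pos k with rfl | hk
  · simp
  · zify [show 1 ≤ 2 * k by omega]
    push_cast at h
    linarith

/-- On skew-symmetric matrices the trace form is a multiple of the dot product of coordinates. -/
lemma trace_skewMatrix_mul {n : ℕ} (c d : SkewIndex n → ℂ) :
    (skewMatrix n c * skewMatrix n d).trace = -2 * (c ⬝ᵥ d) := by
  have hs : ∀ (e : SkewIndex n → ℂ) i j, skewMatrix n e j i = -skewMatrix n e i j :=
    fun e i j => congrFun (congrFun (skewMatrix_transpose e) i) j
  have h := sum_eq_two_mul_sum_skewIndex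
    (fun i j => skewMatrix n c i j * skewMatrix n d i j)
    (fun i j => by rw [hs c i j, hs d i j]; ring)
    (fun i => by simp [skewMatrix_apply])
  have h₁ : (skewMatrix n c * skewMatrix n d).trace
      = -∑ i, ∑ j, skewMatrix n c i j * skewMatrix n d i j := by
    simp only [Matrix.trace, Matrix.diag_apply, Matrix.mul_apply, ← Finset.sum_neg_distrib]
    refine Finset.sum_congr rfl fun i _ => Finset.sum_congr rfl fun j _ => ?_
    rw [hs d i j]; ring
  have h₂ : ∀ (e : SkewIndex n → ℂ) (p : SkewIndex n), skewMatrix n e p.1.1 p.1.2 = e p :=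
    fun e p => congrFun (upperEntries_skewMatrix e) p
  rw [h₁, h]
  simp only [h₂, dotProduct]
  ring

lemma continuous_skewMatrix (n : ℕ) : Continuous (skewMatrix n) :=
  (skewMatrix n).continuous_of_finiteDimensional

/-! ### Ranges of smooth maps from spaces of smaller dimension -/

/-- Finitely many smooth maps from a space of smaller dimension do not cover a neighbourhood. -/
lemma exists_mem_forall_notMem_range {F ι : Type*} {E : ι → Type*}
    [∀ i, NormedAddCommGroup (E i)] [∀ i, NormedSpace ℂ (E i)] [∀ i, FiniteDimensional ℂ (E i)]
    [NormedAddCommGroup F] [NormedSpace ℂ F] [FiniteDimensional ℂ F]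
    [Finite ι] (f : ∀ i, E i → F) (hf : ∀ i, ContDiff ℂ 1 (f i)) {d : ℕ}
    (hE : ∀ i, Module.finrank ℂ (E i) ≤ d) (hd : d < Module.finrank ℂ F)
    {x : F} {U : Set F} (hU : U ∈ 𝓝 x) :
    ∃ y ∈ U, ∀ i, y ∉ Set.range (f i) := by
  let _ : ∀ i, NormedSpace ℝ (E i) := fun i => NormedSpace.restrictScalars ℝ ℂ (E i)
  let _ : NormedSpace ℝ F := NormedSpace.restrictScalars ℝ ℂ F
  have : ∀ i, FiniteDimensional ℝ (E i) := fun i => FiniteDimensional.complexToReal (E i)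
  have : FiniteDimensional ℝ F := FiniteDimensional.complexToReal F
  have hdim : dimH (⋃ i, Set.range (f i)) < Module.finrank ℝ F := by
    rw [dimH_iUnion]
    refine lt_of_le_of_lt (b := ((2 * d : ℕ) : ENNReal)) (iSup_le fun i => ?_) ?_
    · refine ((hf i).restrict_scalars ℝ).dimH_range_le.trans ?_
      rw [finrank_real_of_complex]
      exact_mod_cast Nat.mul_le_mul_left 2 (hE i)
    · rw [finrank_real_of_complex]
      exact_mod_cast Nat.mul_lt_mul_of_pos_left hd two_pos
  obtain ⟨y, hyU, hy⟩ := (dense_compl_of_dimH_lt_finrank hdim).inter_nhds_nonempty hU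
  refine ⟨y, hy, fun i hi => hyU (Set.mem_iUnion.2 ⟨i, hi⟩)⟩

/-- No finite set of congruence classes of `ρ`-dimensional spaces of skew-symmetric matrices contains
all spaces near a given one. In coordinates on `ρ`-tuples: given finitely many tuples, every
nonempty open set contains a tuple which, for every `h ∈ GL_n`, has an entry outside the span of the
transforms by `h` of each given tuple. -/
def HasModuli (ρ n : ℕ) : Prop :=
  ∀ S : Set (Fin ρ → Matrix (Fin n) (Fin n) ℂ), S.Finite →
    ∀ (c₀ : Fin ρ → SkewIndex n → ℂ), ∀ U ∈ 𝓝 c₀, ∃ c ∈ U, ∀ B ∈ S,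
      ∀ (g : Fin ρ → Fin ρ → ℂ) (h : Matrix (Fin n) (Fin n) ℂ), IsUnit h →
        ¬ ∀ j, skewMatrix n (c j) = h.transpose * (∑ l, g j l • B l) * h

/-! ### Counting dimensions -/

/-- The matrix with entry `1` at the position `p` and prescribed entries elsewhere. -/
def normalizedMatrix {n : ℕ} (p : Fin n × Fin n) (x : {q : Fin n × Fin n // q ≠ p} → ℂ) :
    Matrix (Fin n) (Fin n) ℂ :=
  Matrix.of fun a b => if h : (a, b) ≠ p then x ⟨(a, b), h⟩ else 1

lemma exists_eq_smul_normalizedMatrix {n : ℕ} (hn : 0 < n) {h : Matrix (Fin n) (Fin n) ℂ}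
    (hh : IsUnit h) : ∃ (p : Fin n × Fin n) (t : ℂ) (x : {q : Fin n × Fin n // q ≠ p} → ℂ),
      h = t • normalizedMatrix p x := by
  have : Nonempty (Fin n) := ⟨⟨0, hn⟩⟩
  obtain ⟨a, b, hab⟩ : ∃ a b, h a b ≠ 0 := by
    by_contra! hzero
    exact hh.ne_zero (Matrix.ext hzero)
  refine ⟨(a, b), h a b, fun q => h q.1.1 q.1.2 / h a b, ?_⟩
  ext a' b'
  by_cases hq : (a', b') = (a, b)
  · obtain ⟨rfl, rfl⟩ := Prod.mk.inj hq
    simp [normalizedMatrix]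
  · simp only [normalizedMatrix, Matrix.smul_apply, Matrix.of_apply, ne_eq, hq, not_false_eq_true,
      dif_pos, smul_eq_mul, mul_div_cancel₀ _ hab]

/-- The group acting on the `ρ`-tuples is `GL_ρ × GL_n`, of dimension `ρ² + n²`; a one-dimensional
subgroup of scalars acts trivially, which is taken into account by normalizing an entry of the
matrix in `GL_n`. Orbits are too small when `ρ² + n² - 1` is less than the dimension of the space of
tuples. -/
lemma hasModuli_of_dimension_lt {ρ n : ℕ} (hn : 0 < n)
    (hdim : ρ * ρ + n * n ≤ ρ * Fintype.card (SkewIndex n)) : HasModuli ρ n := by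
  intro S hS c₀ U hU
  have : Finite S := hS
  let E : S × (Fin n × Fin n) → Type := fun i =>
    (Fin ρ → Fin ρ → ℂ) × ({q : Fin n × Fin n // q ≠ i.2} → ℂ)
  let _ : ∀ i, NormedAddCommGroup (E i) := fun i => inferInstanceAs (NormedAddCommGroup
    ((Fin ρ → Fin ρ → ℂ) × ({q : Fin n × Fin n // q ≠ i.2} → ℂ)))
  let _ : ∀ i, NormedSpace ℂ (E i) := fun i => inferInstanceAs (NormedSpace ℂ
    ((Fin ρ → Fin ρ → ℂ) × ({q : Fin n × Fin n // q ≠ i.2} → ℂ)))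
  have : ∀ i, FiniteDimensional ℂ (E i) := fun i => inferInstanceAs (FiniteDimensional ℂ
    ((Fin ρ → Fin ρ → ℂ) × ({q : Fin n × Fin n // q ≠ i.2} → ℂ)))
  let f : ∀ i, E i → (Fin ρ → SkewIndex n → ℂ) := fun i y j =>
    upperEntries n ((normalizedMatrix i.2 y.2).transpose * (∑ l, y.1 j l • i.1.1 l) *
      normalizedMatrix i.2 y.2)
  have hf : ∀ i, ContDiff ℂ 1 (f i) := by
    intro i
    have hN : ∀ a b, ContDiff ℂ 1 fun y : E i => normalizedMatrix i.2 y.2 a b := by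
      intro a b
      by_cases hq : (a, b) ≠ i.2
      · have : (fun y : E i => normalizedMatrix i.2 y.2 a b) = fun y => y.2 ⟨(a, b), hq⟩ := by
          funext y
          simp only [normalizedMatrix, Matrix.of_apply, dif_pos hq]
        rw [this]
        exact (contDiff_apply ℂ ℂ (⟨(a, b), hq⟩ : {q : Fin n × Fin n // q ≠ i.2})).comp contDiff_snd
      · have : (fun y : E i => normalizedMatrix i.2 y.2 a b) = fun _ => 1 := by
          funext y
          simp only [normalizedMatrix, Matrix.of_apply, dif_neg hq]
        rw [this]
        exact contDiff_const
    have hg : ∀ j l, ContDiff ℂ 1 fun y : E i => y.1 j l := fun j l =>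
      (contDiff_apply_apply ℂ ℂ j l).comp contDiff_fst
    refine contDiff_pi.2 fun j => contDiff_pi.2 fun p => ?_
    simp only [f, upperEntries_apply, Matrix.mul_apply, Matrix.sum_apply, Matrix.smul_apply,
      Matrix.transpose_apply, smul_eq_mul]
    exact ContDiff.sum fun a _ => (ContDiff.sum fun b _ => (hN _ _).mul
      (ContDiff.sum fun l _ => (hg _ _).mul contDiff_const)).mul (hN _ _)
  have hE : ∀ i, Module.finrank ℂ (E i) ≤ ρ * ρ + (n * n - 1) := by
    intro i
    have : Module.finrank ℂ (E i) = Module.finrank ℂ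
      ((Fin ρ → Fin ρ → ℂ) × ({q : Fin n × Fin n // q ≠ i.2} → ℂ)) := rfl
    rw [this, Module.finrank_prod, Module.finrank_pi_fintype]
    simp
  have hF : ρ * ρ + (n * n - 1) < Module.finrank ℂ (Fin ρ → SkewIndex n → ℂ) := by
    rw [Module.finrank_pi_fintype]
    simp only [Module.finrank_fintype_fun_eq_card, Finset.sum_const, Finset.card_univ,
      Fintype.card_fin, smul_eq_mul]
    have : 0 < n * n := Nat.mul_pos hn hn
    omega
  obtain ⟨c, hcU, hc⟩ := exists_mem_forall_notMem_range f hf hE hF hU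
  refine ⟨c, hcU, fun B hB g h hh heq => ?_⟩
  obtain ⟨p, t, x, rfl⟩ := exists_eq_smul_normalizedMatrix hn hh
  refine hc (⟨B, hB⟩, p) ⟨(fun j l => t ^ 2 * g j l, x), ?_⟩
  funext j
  have : skewMatrix n (c j) = (normalizedMatrix p x).transpose *
      (∑ l, (t ^ 2 * g j l) • B l) * normalizedMatrix p x := by
    simp only [heq j, mul_smul (t ^ 2), ← Finset.smul_sum, Matrix.transpose_smul, Matrix.smul_mul,
      Matrix.mul_smul]
    rw [smul_smul, ← pow_two]
  change upperEntries n ((normalizedMatrix p x).transpose *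
      (∑ l, (t ^ 2 * g j l) • B l) * normalizedMatrix p x) = c j
  rw [← this, upperEntries_skewMatrix]

/-- For `3 ≤ ρ ≤ N - 3`, where `N = k (2k - 1)`, the Grassmannian of `ρ`-dimensional spaces of
skew-symmetric matrices has dimension `ρ (N - ρ) ≥ 3 (N - 3) > 4 k² - 1`. -/
lemma hasModuli_of_three_le {k ρ : ℕ} (hk : 3 ≤ k) (hρ : 3 ≤ ρ)
    (hρ' : ρ + 3 ≤ k * (2 * k - 1)) : HasModuli ρ (2 * k) := by
  refine hasModuli_of_dimension_lt (by omega) ?_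
  rw [card_skewIndex]
  obtain ⟨m, rfl⟩ := Nat.exists_eq_add_of_le hk
  have h₁ : 2 * (3 + m) - 1 = 5 + 2 * m := by omega
  rw [h₁] at hρ' ⊢
  obtain ⟨a, rfl⟩ := Nat.exists_eq_add_of_le hρ
  obtain ⟨b, hb⟩ := Nat.exists_eq_add_of_le hρ'
  rw [hb]
  nlinarith [Nat.zero_le (a * b), Nat.zero_le m]

/-! ### Pencils of skew-symmetric matrices -/

/-- The polynomial in the entries of a pencil `(A, B)` whose nonvanishing says that `A` is
invertible and that certain four diagonal entries of `1, T, T², T³`, with `T = (adj A) B`, form an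
invertible matrix. -/
def pencilMinor {n : ℕ} {R : Type*} [CommRing R] (e : Fin 4 → Fin n)
    (A B : Matrix (Fin n) (Fin n) R) : R :=
  A.det * (Matrix.of fun i j : Fin 4 => ((A.adjugate * B) ^ (j : ℕ)) (e i) (e i)).det

lemma map_pencilMinor {n : ℕ} {R R' : Type*} [CommRing R] [CommRing R'] (φ : R →+* R')
    (e : Fin 4 → Fin n) (A B : Matrix (Fin n) (Fin n) R) :
    φ (pencilMinor e A B) = pencilMinor e (φ.mapMatrix A) (φ.mapMatrix B) := by
  simp only [pencilMinor, map_mul, RingHom.map_det]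
  congr 2
  ext i j
  simp only [RingHom.mapMatrix_apply, Matrix.map_apply, Matrix.of_apply]
  rw [← RingHom.mapMatrix_apply φ A, ← RingHom.map_adjugate, ← RingHom.mapMatrix_apply φ B,
    ← map_mul, ← map_pow]
  rfl

/-- The standard symplectic matrix, with nonzero entries on the antidiagonal. -/
def antidiagonalSkew (n : ℕ) : Matrix (Fin n) (Fin n) ℂ :=
  Matrix.of fun i j => if j = i.rev then (if i < i.rev then 1 else -1) else 0

/-- The eigenvalues of the reference pencil, constant on the pairs `{i, n - 1 - i}`. -/
def pairedEigenvalue {n : ℕ} (i : Fin n) : ℂ := ((min (i : ℕ) (i.rev : ℕ) : ℕ) : ℂ)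

lemma pairedEigenvalue_rev {n : ℕ} (i : Fin n) :
    pairedEigenvalue i.rev = pairedEigenvalue i := by
  simp only [pairedEigenvalue, Fin.rev_rev, min_comm]

lemma antidiagonalSkew_swap (k : ℕ) (i j : Fin (2 * k)) :
    antidiagonalSkew (2 * k) j i = -antidiagonalSkew (2 * k) i j := by
  simp only [antidiagonalSkew, Matrix.of_apply]
  by_cases h : j = i.rev
  · subst h
    have hi : (i : ℕ) < 2 * k := i.2
    simp only [Fin.rev_rev, if_true, Fin.lt_def, Fin.val_rev]
    split_ifs <;> first | omega | simp
  · have h' : i ≠ j.rev := fun h' => h (by rw [h', Fin.rev_rev])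
    simp [h, h']

lemma antidiagonalSkew_mul_self (k : ℕ) :
    antidiagonalSkew (2 * k) * antidiagonalSkew (2 * k) = -1 := by
  ext i j
  rw [Matrix.mul_apply, Finset.sum_eq_single i.rev]
  · by_cases h : j = i
    · subst h
      rw [antidiagonalSkew_swap k j j.rev]
      simp only [antidiagonalSkew, Matrix.of_apply, if_true, Matrix.neg_apply, Matrix.one_apply_eq]
      have hi : (j : ℕ) < 2 * k := j.2
      simp only [Fin.lt_def, Fin.val_rev]
      split_ifs <;> first | omega | simp
    · simp [antidiagonalSkew, h, Ne.symm h, Fin.rev_rev]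
  · intro a _ ha
    simp [antidiagonalSkew, ha]
  · simp

/-- The minor does not vanish at the pencil `(J, J Λ)`, where `J` is the standard symplectic matrix
and `Λ` is diagonal with `0, 1, 2, 3` among its entries: it is a Vandermonde determinant up to
nonzero factors. -/
lemma exists_pencilMinor_ne_zero {k : ℕ} (hk : 4 ≤ k) :
    ∃ (e : Fin 4 → Fin (2 * k)) (a b : SkewIndex (2 * k) → ℂ),
      pencilMinor e (skewMatrix _ a) (skewMatrix _ b) ≠ 0 := by
  set J := antidiagonalSkew (2 * k) with hJ
  set Λ : Matrix (Fin (2 * k)) (Fin (2 * k)) ℂ := Matrix.diagonal pairedEigenvalue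
  have hJskew : J.transpose = -J := by
    ext i j
    exact antidiagonalSkew_swap k i j
  have hJΛ : (J * Λ).transpose = -(J * Λ) := by
    ext i j
    simp only [Matrix.transpose_apply, Matrix.neg_apply, Λ, Matrix.mul_diagonal, hJ]
    rw [antidiagonalSkew_swap k i j]
    by_cases h : j = i.rev
    · subst h
      rw [pairedEigenvalue_rev]; ring
    · simp [antidiagonalSkew, h]
  have hdet : J.det ≠ 0 := by
    have h : J * -J = 1 := by rw [mul_neg, antidiagonalSkew_mul_self, neg_neg]
    exact (Matrix.isUnit_iff_isUnit_det J).1 (IsUnit.of_mul_eq_one _ h) |>.ne_zero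
  refine ⟨fun i => ⟨i, by omega⟩, upperEntries _ J, upperEntries _ (J * Λ), ?_⟩
  rw [skewMatrix_upperEntries hJskew, skewMatrix_upperEntries hJΛ, pencilMinor]
  refine mul_ne_zero hdet ?_
  have hpow : ∀ m : ℕ, (J.adjugate * (J * Λ)) ^ m =
      Matrix.diagonal fun i => (J.det * pairedEigenvalue i) ^ m := by
    intro m
    have h : J.adjugate * (J * Λ) = Matrix.diagonal fun i => J.det * pairedEigenvalue i := by
      rw [← mul_assoc, Matrix.adjugate_mul, Matrix.smul_mul, one_mul, ← Matrix.diagonal_smul]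
      rfl
    rw [h, Matrix.diagonal_pow]
    rfl
  have hvand : (Matrix.of fun i j : Fin 4 => ((J.adjugate * (J * Λ)) ^ (j : ℕ))
      (⟨i, by omega⟩ : Fin (2 * k)) (⟨i, by omega⟩ : Fin (2 * k))) =
      Matrix.vandermonde fun i : Fin 4 => J.det * (i : ℕ) := by
    ext i j
    simp only [hpow, Matrix.of_apply, Matrix.diagonal_apply_eq, Matrix.vandermonde_apply]
    congr 2
    simp only [pairedEigenvalue, Fin.val_rev]
    congr 1
    exact min_eq_left (by omega)
  rw [hvand, Matrix.det_vandermonde_ne_zero_iff]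
  intro i j hij
  exact Fin.ext (by exact_mod_cast mul_left_cancel₀ hdet hij)

/-- For a generic pencil `(A, B)` of skew-symmetric matrices of size at least `8`, the matrix `A` is
invertible and `1, T, T², T³` are linearly independent for `T = A⁻¹ B`. -/
lemma exists_generic_pencil {k : ℕ} (hk : 4 ≤ k) (c₀ : Fin 2 → SkewIndex (2 * k) → ℂ)
    {U : Set (Fin 2 → SkewIndex (2 * k) → ℂ)} (hU : U ∈ 𝓝 c₀) :
    ∃ c ∈ U, IsUnit (skewMatrix _ (c 0)).det ∧ ∀ q : Fin 4 → ℂ,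
      ∑ j, q j • ((skewMatrix _ (c 0))⁻¹ * skewMatrix _ (c 1)) ^ (j : ℕ) = 0 → q = 0 := by
  obtain ⟨e, a, b, hab⟩ := exists_pencilMinor_ne_zero hk
  let d : Fin 2 → SkewIndex (2 * k) → ℂ := ![a, b]
  let c : ℂ → Fin 2 → SkewIndex (2 * k) → ℂ := fun t => c₀ + t • (d - c₀)
  -- The minor along the line from `c₀` to the reference pencil, as a polynomial.
  let P : Fin 2 → Matrix (Fin (2 * k)) (Fin (2 * k)) (Polynomial ℂ) := fun m =>
    Matrix.of fun i j => Polynomial.C (skewMatrix _ (c₀ m) i j) +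
      Polynomial.X * Polynomial.C (skewMatrix _ (d m - c₀ m) i j)
  have hP : ∀ t m, (Polynomial.evalRingHom t).mapMatrix (P m) = skewMatrix _ (c t m) := by
    intro t m
    ext i j
    simp [P, c]
  have heval : ∀ t, (pencilMinor e (P 0) (P 1)).eval t =
      pencilMinor e (skewMatrix _ (c t 0)) (skewMatrix _ (c t 1)) := by
    intro t
    rw [← Polynomial.coe_evalRingHom, map_pencilMinor, hP, hP]
  have hne : pencilMinor e (P 0) (P 1) ≠ 0 := by
    intro h0
    have h := heval 1
    rw [h0, Polynomial.eval_zero] at h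
    apply hab
    simpa [c, d] using h.symm
  have hV : c ⁻¹' U ∈ 𝓝 (0 : ℂ) := by
    have hc : Continuous c := by fun_prop
    refine hc.continuousAt.preimage_mem_nhds ?_
    simpa [c] using hU
  obtain ⟨t, htU, ht⟩ :=
    (infinite_of_mem_nhds 0 hV).exists_notMem_finset (pencilMinor e (P 0) (P 1)).roots.toFinset
  rw [Multiset.mem_toFinset, Polynomial.mem_roots hne, Polynomial.IsRoot.def, heval] at ht
  have hdet := left_ne_zero_of_mul ht
  refine ⟨c t, htU, hdet.isUnit, fun q hq => ?_⟩
  set A := skewMatrix _ (c t 0)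
  set B := skewMatrix _ (c t 1)
  have hinv : A⁻¹ * B = A.det⁻¹ • (A.adjugate * B) := by
    rw [Matrix.inv_def, Ring.inverse_eq_inv', Matrix.smul_mul]
  have hzero : (Matrix.of fun i j : Fin 4 => ((A.adjugate * B) ^ (j : ℕ)) (e i) (e i)).mulVec
      (fun j => q j * A.det⁻¹ ^ (j : ℕ)) = 0 := by
    ext i
    have h := congrFun (congrFun hq (e i)) (e i)
    simp only [hinv, smul_pow, Matrix.sum_apply, Matrix.smul_apply, smul_eq_mul,
      Matrix.zero_apply] at h
    simp only [Matrix.mulVec, dotProduct, Matrix.of_apply, Pi.zero_apply]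
    rw [← h]
    exact Finset.sum_congr rfl fun j _ => by ring
  have := Matrix.eq_zero_of_mulVec_eq_zero (right_ne_zero_of_mul ht) hzero
  ext j
  have hj : q j * A.det⁻¹ ^ (j : ℕ) = 0 := congrFun this j
  exact (mul_eq_zero.1 hj).resolve_right (pow_ne_zero _ (inv_ne_zero hdet))

/-- The first-order variation of `A ^ m` in the direction `B`. -/
def powVariation {n : ℕ} (A B : Matrix (Fin n) (Fin n) ℂ) : ℕ → Matrix (Fin n) (Fin n) ℂ
  | 0 => 0
  | m + 1 => powVariation A B m * A + A ^ m * B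

/-- By cyclicity of the trace, the variation of `tr (A ^ (m + 1))` in the direction `B` is
`(m + 1) tr (A ^ m B)`; the factor `A ^ l` is there for the induction on `m`. -/
lemma trace_powVariation_mul_pow {n : ℕ} (A B : Matrix (Fin n) (Fin n) ℂ) (m l : ℕ) :
    (powVariation A B (m + 1) * A ^ l).trace = (m + 1) * (A ^ (m + l) * B).trace := by
  induction m generalizing l with
  | zero =>
    simp [powVariation, Matrix.trace_mul_comm B]
  | succ m ih =>
    have h := ih (l + 1)
    rw [powVariation, add_mul, Matrix.trace_add, mul_assoc, ← pow_succ', h, mul_assoc,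
      Matrix.trace_mul_comm (A ^ (m + 1)), mul_assoc, ← pow_add, Matrix.trace_mul_comm B,
      show m + (l + 1) = l + (m + 1) by ring, show m + 1 + l = l + (m + 1) by ring]
    push_cast
    ring

lemma hasDerivAt_pow_apply {n : ℕ} (A B : Matrix (Fin n) (Fin n) ℂ) (m : ℕ) (i j : Fin n) :
    HasDerivAt (fun t : ℂ => ((A + t • B) ^ m) i j) (powVariation A B m i j) 0 := by
  induction m generalizing i j with
  | zero => simpa [powVariation] using hasDerivAt_const (0 : ℂ) ((1 : Matrix _ _ ℂ) i j)
  | succ m ih =>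
    have hAB : ∀ a b, HasDerivAt (fun t : ℂ => (A + t • B) a b) (B a b) 0 := by
      intro a b
      simpa using ((hasDerivAt_id (0 : ℂ)).mul_const (B a b)).const_add (A a b)
    simp only [pow_succ, Matrix.mul_apply, powVariation, Matrix.add_apply (powVariation A B m * A),
      ← Finset.sum_add_distrib]
    refine HasDerivAt.fun_sum fun a _ => ?_
    have h := (ih i a).fun_mul (hAB a j)
    simp only [zero_smul, add_zero] at h
    exact h

lemma contDiff_pow_apply {E : Type*} [NormedAddCommGroup E] [NormedSpace ℂ E] {n : ℕ}
    {X : E → Matrix (Fin n) (Fin n) ℂ} {l : WithTop ℕ∞} (hX : ∀ i j, ContDiff ℂ l fun x => X x i j)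
    (m : ℕ) (i j : Fin n) : ContDiff ℂ l fun x => (X x ^ m) i j := by
  induction m generalizing i j with
  | zero => simpa using contDiff_const
  | succ m ih =>
    simp only [pow_succ, Matrix.mul_apply]
    exact ContDiff.sum fun a _ => (ih i a).mul (hX a j)

/-- The first four power sums of the eigenvalues of a matrix. -/
def powerTraces {n : ℕ} (X : Matrix (Fin n) (Fin n) ℂ) : Fin 4 → ℂ :=
  fun j => (X ^ ((j : ℕ) + 1)).trace

lemma contDiff_powerTraces {E : Type*} [NormedAddCommGroup E] [NormedSpace ℂ E] {n : ℕ}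
    {X : E → Matrix (Fin n) (Fin n) ℂ} {l : WithTop ℕ∞}
    (hX : ∀ i j, ContDiff ℂ l fun x => X x i j) : ContDiff ℂ l fun x => powerTraces (X x) := by
  refine contDiff_pi.2 fun j => ?_
  simp only [powerTraces, Matrix.trace, Matrix.diag_apply]
  exact ContDiff.sum fun i _ => contDiff_pow_apply hX _ _ _

lemma contDiff_mul_skewMatrix {n : ℕ} (P : Matrix (Fin n) (Fin n) ℂ) {l : WithTop ℕ∞}
    (i j : Fin n) : ContDiff ℂ l fun x : SkewIndex n → ℂ => (P * skewMatrix n x) i j := by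
  have : (fun x : SkewIndex n → ℂ => (P * skewMatrix n x) i j) =
      (LinearMap.toContinuousLinearMap
        ((Matrix.entryLinearMap ℂ ℂ i j) ∘ₗ (LinearMap.mulLeft ℂ P) ∘ₗ skewMatrix n)) := by
    ext x
    rfl
  rw [this]
  exact ContinuousLinearMap.contDiff _

open scoped ComplexOrder in
/-- A nonzero skew-symmetric matrix is not orthogonal to all skew-symmetric matrices. -/
lemma eq_zero_of_forall_trace_mul_skewMatrix {n : ℕ} {Q : Matrix (Fin n) (Fin n) ℂ}
    (hQ : Q.transpose = -Q) (h : ∀ x, (Q * skewMatrix n x).trace = 0) : Q = 0 := by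
  have hskew : Q.conjTranspose.transpose = -Q.conjTranspose := by
    rw [← Matrix.conjTranspose_neg, ← hQ]
    rfl
  have h' := h (upperEntries n Q.conjTranspose)
  rw [skewMatrix_upperEntries hskew] at h'
  exact Matrix.trace_mul_conjTranspose_self_eq_zero_iff.1 h'

lemma transpose_pow_inv_mul_mul_inv {n : ℕ} {A B : Matrix (Fin n) (Fin n) ℂ}
    (hA : A.transpose = -A) (hB : B.transpose = -B) (hdet : IsUnit A.det) (m : ℕ) :
    ((A⁻¹ * B) ^ m * A⁻¹).transpose = -((A⁻¹ * B) ^ m * A⁻¹) := by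
  have hA' : A⁻¹.transpose = -A⁻¹ := by
    rw [Matrix.transpose_nonsing_inv, hA]
    refine Matrix.inv_eq_left_inv ?_
    rw [neg_mul_neg, Matrix.nonsing_inv_mul _ hdet]
  have hs : SemiconjBy A⁻¹ (B * A⁻¹) (A⁻¹ * B) := by
    rw [SemiconjBy, mul_assoc]
  rw [Matrix.transpose_mul, Matrix.transpose_pow, Matrix.transpose_mul, hA', hB, neg_mul_neg,
    neg_mul, (hs.pow_right m).eq]

/-- If `1, T, T², T³` are linearly independent, where `T = A⁻¹ B`, then the first four power sums of
the eigenvalues of `T` vary independently with `B`. -/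
lemma powerTraces_image_mem_nhds {n : ℕ} {A : Matrix (Fin n) (Fin n) ℂ} (hA : A.transpose = -A)
    (hdet : IsUnit A.det) (b : SkewIndex n → ℂ)
    (hind : ∀ q : Fin 4 → ℂ, ∑ j, q j • (A⁻¹ * skewMatrix n b) ^ (j : ℕ) = 0 → q = 0)
    {W : Set (SkewIndex n → ℂ)} (hW : W ∈ 𝓝 b) :
    (fun x => powerTraces (A⁻¹ * skewMatrix n x)) '' W ∈
      𝓝 (powerTraces (A⁻¹ * skewMatrix n b)) := by
  set Ψ : (SkewIndex n → ℂ) → Fin 4 → ℂ := fun x => powerTraces (A⁻¹ * skewMatrix n x) with hΨ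
  have hcd : ContDiff ℂ 1 Ψ := contDiff_powerTraces (contDiff_mul_skewMatrix A⁻¹)
  have hstrict := hcd.contDiffAt.hasStrictFDerivAt (x := b) (by norm_num)
  set T := A⁻¹ * skewMatrix n b
  have hderiv : ∀ x (j : Fin 4), fderiv ℂ Ψ b x j =
      ((j : ℕ) + 1) * (T ^ (j : ℕ) * (A⁻¹ * skewMatrix n x)).trace := by
    intro x j
    have hline : HasDerivAt (fun t : ℂ => b + t • x) x 0 := by
      simpa using ((hasDerivAt_id (0 : ℂ)).smul_const x).const_add b
    have h₁ : HasDerivAt (fun t : ℂ => Ψ (b + t • x)) (fderiv ℂ Ψ b x) 0 := by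
      have hb : HasFDerivAt Ψ (fderiv ℂ Ψ b) (b + (0 : ℂ) • x) := by
        simpa using hstrict.hasFDerivAt
      exact hb.comp_hasDerivAt (0 : ℂ) hline
    have h₂ : HasDerivAt (fun t : ℂ => Ψ (b + t • x) j)
        ((powVariation T (A⁻¹ * skewMatrix n x) ((j : ℕ) + 1)).trace) 0 := by
      simp only [hΨ, powerTraces, map_add, map_smul, mul_add, Matrix.mul_smul, Matrix.trace,
        Matrix.diag_apply]
      exact HasDerivAt.fun_sum fun i _ => hasDerivAt_pow_apply _ _ _ _ _
    rw [((hasDerivAt_pi.1 h₁) j).unique h₂]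
    simpa using trace_powVariation_mul_pow T (A⁻¹ * skewMatrix n x) j 0
  -- A linear relation between the components of the derivative of `Ψ` would give a skew-symmetric
  -- matrix `Q`, a polynomial in `T` of degree at most `3` times `A⁻¹`, with vanishing pairings.
  have hsurj : (fderiv ℂ Ψ b).range = ⊤ := by
    by_contra hne
    obtain ⟨f, hf, hker⟩ := Submodule.exists_le_ker_of_lt_top _ (lt_top_iff_ne_top.2 hne)
    have hfsum : ∀ y, f y = ∑ j, y j * f (Pi.single j 1) := by
      intro y
      conv_lhs => rw [pi_eq_sum_univ' y]
      simp
    set Q := ∑ j : Fin 4, (f (Pi.single j 1) * ((j : ℕ) + 1)) • (T ^ (j : ℕ) * A⁻¹) with hQ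
    have hQskew : Q.transpose = -Q := by
      simp only [hQ, Matrix.transpose_sum, Matrix.transpose_smul, ← Finset.sum_neg_distrib, T,
        transpose_pow_inv_mul_mul_inv hA (skewMatrix_transpose b) hdet, smul_neg]
    have hQ0 : Q = 0 := by
      refine eq_zero_of_forall_trace_mul_skewMatrix hQskew fun x => ?_
      have hx : f (fderiv ℂ Ψ b x) = 0 := hker ⟨x, rfl⟩
      rw [hfsum] at hx
      rw [← hx, hQ, Finset.sum_mul, Matrix.trace_sum]
      refine Finset.sum_congr rfl fun j _ => ?_
      rw [hderiv, Matrix.smul_mul, Matrix.trace_smul, smul_eq_mul, mul_assoc (T ^ (j : ℕ))]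
      ring
    have hq := hind (fun j => f (Pi.single j 1) * ((j : ℕ) + 1)) (by
      have h : (∑ j : Fin 4, (f (Pi.single j 1) * ((j : ℕ) + 1)) • T ^ (j : ℕ)) * A⁻¹ = 0 := by
        rw [← hQ0, hQ, Finset.sum_mul]
        simp only [Matrix.smul_mul]
      have h' := congrArg (· * A) h
      simpa [mul_assoc, Matrix.nonsing_inv_mul _ hdet] using h')
    apply hf
    ext j
    have hj := congrFun hq j
    have : ((j : ℕ) : ℂ) + 1 ≠ 0 := Nat.cast_add_one_ne_zero _
    simpa [this] using hj
  rw [← hstrict.map_nhds_eq_of_surj hsurj]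
  exact image_mem_map hW

/-- The adjugate of a member of a pencil multiplied by another member, with the first coefficient of
the first member normalized to `1`. -/
def pencilQuotient {n : ℕ} (B₀ B₁ : Matrix (Fin n) (Fin n) ℂ) (y : Fin 3 → ℂ) :
    Matrix (Fin n) (Fin n) ℂ :=
  (B₀ + y 0 • B₁).adjugate * (y 1 • B₀ + y 2 • B₁)

lemma contDiffAt_adjugate_apply {E : Type*} [NormedAddCommGroup E] [NormedSpace ℂ E] {n : ℕ}
    {X : E → Matrix (Fin n) (Fin n) ℂ} {l : WithTop ℕ∞} {x : E}
    (hX : ∀ i j, ContDiffAt ℂ l (fun x => X x i j) x) (i j : Fin n) :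
    ContDiffAt ℂ l (fun x => (X x).adjugate i j) x := by
  simp only [Matrix.adjugate_apply, Matrix.det_apply]
  refine ContDiffAt.sum fun σ _ => ContDiffAt.const_smul _ (contDiffAt_prod fun a _ => ?_)
  by_cases h : σ a = j
  · simp only [h, Matrix.updateRow_self]
    exact contDiffAt_const
  · simp only [Matrix.updateRow_ne h]
    exact hX _ _

lemma contDiff_pencilQuotient_apply {n : ℕ} (B₀ B₁ : Matrix (Fin n) (Fin n) ℂ)
    {l : WithTop ℕ∞} (i j : Fin n) : ContDiff ℂ l fun y => pencilQuotient B₀ B₁ y i j := by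
  have hy : ∀ m : Fin 3, ContDiff ℂ l fun y : Fin 3 → ℂ => y m := fun m => contDiff_apply ℂ ℂ m
  simp only [pencilQuotient, Matrix.mul_apply, Matrix.add_apply, Matrix.smul_apply, smul_eq_mul]
  refine ContDiff.sum fun a _ => ContDiff.mul (contDiff_iff_contDiffAt.2 fun y =>
    contDiffAt_adjugate_apply (fun i j => ?_) _ _)
    (((hy 1).mul contDiff_const).add ((hy 2).mul contDiff_const))
  exact (contDiff_const.add ((hy 0).mul contDiff_const)).contDiffAt

/-- Congruent pencils have similar quotients. -/
lemma powerTraces_inv_mul_congr {n : ℕ} {h : Matrix (Fin n) (Fin n) ℂ} (hh : IsUnit h.det)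
    (K L : Matrix (Fin n) (Fin n) ℂ) :
    powerTraces ((h.transpose * K * h)⁻¹ * (h.transpose * L * h)) = powerTraces (K⁻¹ * L) := by
  have hht : IsUnit h.transpose.det := by rwa [Matrix.det_transpose]
  have hT : (h.transpose * K * h)⁻¹ * (h.transpose * L * h) = h⁻¹ * (K⁻¹ * L) * h := by
    rw [Matrix.mul_inv_rev, Matrix.mul_inv_rev]
    simp only [mul_assoc]
    rw [Matrix.nonsing_inv_mul_cancel_left _ _ hht]
  have hs : SemiconjBy h (h⁻¹ * (K⁻¹ * L) * h) (K⁻¹ * L) := by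
    rw [SemiconjBy, mul_assoc h⁻¹, Matrix.mul_nonsing_inv_cancel_left _ _ hh]
  funext j
  rw [hT, powerTraces, powerTraces]
  have hp := (hs.pow_right ((j : ℕ) + 1)).eq
  have : (h⁻¹ * (K⁻¹ * L) * h) ^ ((j : ℕ) + 1) = h⁻¹ * ((K⁻¹ * L) ^ ((j : ℕ) + 1) * h) := by
    rw [← hp, Matrix.nonsing_inv_mul_cancel_left _ _ hh]
  rw [this, Matrix.trace_mul_comm, Matrix.mul_nonsing_inv_cancel_right _ _ hh]

/-- The quotient `K⁻¹ L` of two members of a pencil depends on three parameters only. -/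
lemma exists_pencilQuotient_eq {n : ℕ} {B₀ B₁ : Matrix (Fin n) (Fin n) ℂ} {a b c d : ℂ}
    (ha : a ≠ 0) (hK : IsUnit (a • B₀ + b • B₁).det) :
    ∃ y, (a • B₀ + b • B₁)⁻¹ * (c • B₀ + d • B₁) = pencilQuotient B₀ B₁ y := by
  have hK' : a • B₀ + b • B₁ = a • (B₀ + (b / a) • B₁) := by
    rw [smul_add, smul_smul, mul_div_cancel₀ _ ha]
  have hunit : IsUnit (B₀ + (b / a) • B₁).det := by
    rw [hK', Matrix.det_smul] at hK
    exact isUnit_of_mul_isUnit_right hK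
  set u := a⁻¹ * (B₀ + (b / a) • B₁).det⁻¹
  refine ⟨![b / a, u * c, u * d], ?_⟩
  have hinv : (a • B₀ + b • B₁)⁻¹ = u • (B₀ + (b / a) • B₁).adjugate := by
    rw [hK']
    refine Matrix.inv_eq_left_inv ?_
    rw [Matrix.smul_mul, Matrix.mul_smul, Matrix.adjugate_mul, smul_smul, smul_smul]
    have : u * a * (B₀ + (b / a) • B₁).det = 1 := by
      have := hunit.ne_zero
      simp only [u]
      field_simp
    rw [this, one_smul]
  rw [hinv]
  simp [pencilQuotient, ← Matrix.mul_smul, smul_add, smul_smul]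

/-- The eigenvalues of `A⁻¹ B` form a set of `k ≥ 4` points of the projective line, defined up to
projective transformations: there are moduli. Here the moduli are detected by the first four power
sums, which take values in a subset of dimension three on each congruence class of pencils. -/
lemma hasModuli_two {k : ℕ} (hk : 4 ≤ k) : HasModuli 2 (2 * k) := by
  intro S hS c₀ U hU
  have : Finite S := hS
  obtain ⟨U', hU'U, hU'o, hc₀⟩ := mem_nhds_iff.1 hU
  obtain ⟨c₁, hc₁U, hdet, hind⟩ := exists_generic_pencil hk c₀ (hU'o.mem_nhds hc₀)
  set A := skewMatrix (2 * k) (c₁ 0) with hA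
  have hW : {x | ![c₁ 0, x] ∈ U'} ∈ 𝓝 (c₁ 1) := by
    have hcont : Continuous fun x : SkewIndex (2 * k) → ℂ => ![c₁ 0, x] := by
      refine continuous_pi fun j => ?_
      fin_cases j
      · exact continuous_const
      · exact continuous_id
    refine hcont.continuousAt.preimage_mem_nhds (hU'o.mem_nhds ?_)
    have : ![c₁ 0, c₁ 1] = c₁ := by
      funext j
      fin_cases j <;> rfl
    rwa [this]
  let f : S × (Fin 2 × Fin 2) → (Fin 3 → ℂ) → (Fin 4 → ℂ) := fun i y =>
    powerTraces (pencilQuotient (i.1.1 i.2.1) (i.1.1 i.2.2) y)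
  obtain ⟨-, ⟨x, hxW, rfl⟩, hx⟩ := exists_mem_forall_notMem_range f
    (fun i => contDiff_powerTraces (contDiff_pencilQuotient_apply _ _)) (d := 3)
    (fun i => by simp) (by simp)
    (powerTraces_image_mem_nhds (skewMatrix_transpose _) hdet (c₁ 1) hind hW)
  refine ⟨![c₁ 0, x], hU'U hxW, fun B hB g h hh heq => ?_⟩
  have h0 := heq 0
  have h1 := heq 1
  simp only [Matrix.cons_val_zero, Matrix.cons_val_one, Fin.sum_univ_two] at h0 h1
  have hhdet := (Matrix.isUnit_iff_isUnit_det h).1 hh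
  have hK : IsUnit (g 0 0 • B 0 + g 0 1 • B 1).det := by
    rw [hA, h0, Matrix.det_mul, Matrix.det_mul] at hdet
    exact isUnit_of_mul_isUnit_right (isUnit_of_mul_isUnit_left hdet)
  have htr : powerTraces (A⁻¹ * skewMatrix _ x) = powerTraces
      ((g 0 0 • B 0 + g 0 1 • B 1)⁻¹ * (g 1 0 • B 0 + g 1 1 • B 1)) := by
    rw [hA, h0, h1, powerTraces_inv_mul_congr hhdet]
  by_cases ha : g 0 0 = 0
  · have hb : g 0 1 ≠ 0 := by
      intro hb
      have : NeZero (2 * k) := ⟨by omega⟩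
      simp [ha, hb, Matrix.det_zero] at hK
    rw [add_comm (g 0 0 • B 0), add_comm (g 1 0 • B 0)] at htr
    rw [add_comm (g 0 0 • B 0)] at hK
    obtain ⟨y, hy⟩ := exists_pencilQuotient_eq (c := g 1 1) (d := g 1 0) hb hK
    exact hx (⟨B, hB⟩, 1, 0) ⟨y, (htr.trans (congrArg powerTraces hy)).symm⟩
  · obtain ⟨y, hy⟩ := exists_pencilQuotient_eq (c := g 1 0) (d := g 1 1) ha hK
    exact hx (⟨B, hB⟩, 0, 1) ⟨y, (htr.trans (congrArg powerTraces hy)).symm⟩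

/-! ### First-order consequences of simplicity -/

/-- The action of a matrix on matrices by congruence. -/
def congruence {n : ℕ} (h : Matrix (Fin n) (Fin n) ℂ) :
    Matrix (Fin n) (Fin n) ℂ →ₗ[ℂ] Matrix (Fin n) (Fin n) ℂ :=
  LinearMap.mulLeft ℂ h.transpose ∘ₗ LinearMap.mulRight ℂ h

lemma congruence_apply {n : ℕ} (h X : Matrix (Fin n) (Fin n) ℂ) :
    congruence h X = h.transpose * X * h := (mul_assoc _ _ _).symm

lemma congruence_injective {n : ℕ} {h : Matrix (Fin n) (Fin n) ℂ} (hh : IsUnit h) :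
    Function.Injective (congruence h) := by
  have hht : IsUnit h.transpose := by
    rw [Matrix.isUnit_iff_isUnit_det, Matrix.det_transpose]
    exact (Matrix.isUnit_iff_isUnit_det h).1 hh
  intro X Y hXY
  rw [congruence_apply, congruence_apply] at hXY
  exact hht.mul_left_cancel (hh.mul_right_cancel hXY)

lemma differentiableAt_inv_apply {E : Type*} [NormedAddCommGroup E] [NormedSpace ℂ E] {n : ℕ}
    {X : E → Matrix (Fin n) (Fin n) ℂ} {x : E} (hX : ∀ i j, ContDiffAt ℂ 1 (fun x => X x i j) x)
    (hx : IsUnit (X x)) (i j : Fin n) : DifferentiableAt ℂ (fun x => (X x)⁻¹ i j) x := by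
  have hdet : ContDiffAt ℂ 1 (fun x => (X x).det) x := by
    simp only [Matrix.det_apply]
    exact ContDiffAt.sum fun σ _ => ContDiffAt.const_smul _ (contDiffAt_prod fun a _ => hX _ _)
  have hne : (X x).det ≠ 0 := ((Matrix.isUnit_iff_isUnit_det _).1 hx).ne_zero
  simp only [Matrix.inv_def, Ring.inverse_eq_inv', Matrix.smul_apply, smul_eq_mul]
  exact ((hdet.inv hne).mul (contDiffAt_adjugate_apply hX i j)).differentiableAt (by norm_num)

lemma differentiableAt_mul_apply {E : Type*} [NormedAddCommGroup E] [NormedSpace ℂ E] {n : ℕ}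
    {X Y : E → Matrix (Fin n) (Fin n) ℂ} {x : E}
    (hX : ∀ i j, DifferentiableAt ℂ (fun x => X x i j) x)
    (hY : ∀ i j, DifferentiableAt ℂ (fun x => Y x i j) x) (i j : Fin n) :
    DifferentiableAt ℂ (fun x => (X x * Y x) i j) x := by
  simp only [Matrix.mul_apply]
  exact DifferentiableAt.fun_sum fun a _ => (hX i a).mul (hY a j)

/-- Equivalent germs vanishing at `0` have derivatives which agree up to a linear change of
variables and a congruence. No regularity of the second germ is assumed: it follows from the
equivalence. -/
lemma exists_derivAtZero_eq_congruence {s n : ℕ} {M₁ M₂ : (Fin s → ℂ) → Matrix (Fin n) (Fin n) ℂ}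
    (hM₁ : ∀ i j, AnalyticAt ℂ (fun x => M₁ x i j) 0) (h0 : M₁ 0 = 0) (h : SkEquiv M₁ M₂) :
    ∃ a : Matrix (Fin n) (Fin n) ℂ, IsUnit a ∧
      LinearMap.range (derivAtZero M₁) =
        (LinearMap.range (derivAtZero M₂)).map (congruence a) := by
  obtain ⟨φ, A, ⟨hφ0, hφ, ψ, hψ0, hψ, hψφ, hφψ⟩, hA, hunit, heq⟩ := h
  have hA0 : IsUnit (A 0) := hunit.self_of_nhds
  have hA0t : IsUnit (A 0).transpose := by
    rw [Matrix.isUnit_iff_isUnit_det, Matrix.det_transpose]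
    exact (Matrix.isUnit_iff_isUnit_det _).1 hA0
  have hφd : HasFDerivAt φ (fderiv ℂ φ 0) 0 := hφ.differentiableAt.hasFDerivAt
  have hMφ : ∀ i j, HasFDerivAt (fun x => M₁ (φ x) i j)
      ((fderiv ℂ (fun x => M₁ x i j) 0).comp (fderiv ℂ φ 0)) 0 := by
    intro i j
    have h₁ : HasFDerivAt (fun x => M₁ x i j) (fderiv ℂ (fun x => M₁ x i j) 0) (φ 0) := by
      rw [hφ0]
      exact (hM₁ i j).differentiableAt.hasFDerivAt
    exact h₁.comp 0 hφd
  have hM₂0 : M₂ 0 = 0 := by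
    have := heq.self_of_nhds
    rw [hφ0, h0] at this
    have h' : congruence (A 0) (M₂ 0) = congruence (A 0) 0 := by
      rw [congruence_apply, ← this, map_zero]
    exact congruence_injective hA0 h'
  -- The second germ is `A⁻ᵀ (M₁ ∘ φ) A⁻¹` near `0`.
  have hM₂d : ∀ i j, DifferentiableAt ℂ (fun x => M₂ x i j) 0 := by
    have hinv : ∀ i j, DifferentiableAt ℂ (fun x => (A x)⁻¹ i j) 0 :=
      differentiableAt_inv_apply (fun i j => (hA i j).contDiffAt) hA0
    have hev : ∀ᶠ x in 𝓝 0, M₂ x = (A x)⁻¹.transpose * M₁ (φ x) * (A x)⁻¹ := by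
      filter_upwards [hunit, heq] with x hx hxeq
      have hx' := (Matrix.isUnit_iff_isUnit_det _).1 hx
      have hxt : IsUnit (A x).transpose.det := by rwa [Matrix.det_transpose]
      rw [hxeq, Matrix.transpose_nonsing_inv]
      simp only [mul_assoc]
      rw [Matrix.nonsing_inv_mul_cancel_left _ _ hxt, Matrix.mul_nonsing_inv _ hx', mul_one]
    intro i j
    refine DifferentiableAt.congr_of_eventuallyEq
      (f := fun x => ((A x)⁻¹.transpose * M₁ (φ x) * (A x)⁻¹) i j) ?_
      (hev.mono fun x hx => by simp only [hx])
    exact differentiableAt_mul_apply (differentiableAt_mul_apply (fun i j => hinv j i)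
      fun i j => (hMφ i j).differentiableAt) hinv i j
  have hkey : ∀ v, derivAtZero M₁ (fderiv ℂ φ 0 v) = congruence (A 0) (derivAtZero M₂ v) := by
    intro v
    ext i j
    have hAd : ∀ i j, HasFDerivAt (fun x => A x i j) (fderiv ℂ (fun x => A x i j) 0) 0 :=
      fun i j => (hA i j).differentiableAt.hasFDerivAt
    have h₁ := (hMφ i j).congr_of_eventuallyEq
      (f₁ := fun x => ((A x).transpose * M₂ x * A x) i j) (heq.mono fun x hx => by simp only [hx])
    simp only [Matrix.mul_apply, Matrix.transpose_apply] at h₁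
    have h₂ := HasFDerivAt.fun_sum (u := Finset.univ) fun b (_ : b ∈ Finset.univ) =>
      (HasFDerivAt.fun_sum (u := Finset.univ) fun a (_ : a ∈ Finset.univ) =>
        (hAd a i).fun_mul (hM₂d a b).hasFDerivAt).fun_mul (hAd b j)
    have h₃ := congrArg (fun f : (Fin s → ℂ) →L[ℂ] ℂ => f v) (h₁.unique h₂)
    simp only [ContinuousLinearMap.comp_apply] at h₃
    change fderiv ℂ (fun x => M₁ x i j) 0 (fderiv ℂ φ 0 v) = _
    rw [h₃, congruence_apply]
    simp only [hM₂0, Matrix.mul_apply, Matrix.transpose_apply, derivAtZero, LinearMap.coe_mk,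
      AddHom.coe_mk, Matrix.of_apply, Matrix.zero_apply]
    simp [Finset.mul_sum, mul_comm]
  have hsurj : ∀ w, ∃ v, fderiv ℂ φ 0 v = w := by
    intro w
    have h₁ : HasFDerivAt (fun x => φ (ψ x)) ((fderiv ℂ φ 0).comp (fderiv ℂ ψ 0)) 0 := by
      have : HasFDerivAt φ (fderiv ℂ φ 0) (ψ 0) := by rwa [hψ0]
      exact this.comp 0 hψ.differentiableAt.hasFDerivAt
    have h₂ := (hasFDerivAt_id (𝕜 := ℂ) (0 : Fin s → ℂ)).congr_of_eventuallyEq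
      (f₁ := fun x => φ (ψ x)) hφψ
    exact ⟨fderiv ℂ ψ 0 w, by
      simpa using congrArg (fun f : (Fin s → ℂ) →L[ℂ] (Fin s → ℂ) => f w) (h₁.unique h₂)⟩
  refine ⟨A 0, hA0, le_antisymm ?_ ?_⟩
  · rintro _ ⟨w, rfl⟩
    obtain ⟨v, rfl⟩ := hsurj w
    exact ⟨_, ⟨v, rfl⟩, (hkey v).symm⟩
  · rintro _ ⟨_, ⟨v, rfl⟩, rfl⟩
    exact ⟨_, hkey v⟩

/-- The linear form with given coefficients. -/
noncomputable def linearForm {s : ℕ} (c : Fin s → ℂ) : (Fin s → ℂ) →L[ℂ] ℂ :=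
  ∑ m, c m • ContinuousLinearMap.proj m

lemma linearForm_apply {s : ℕ} (c x : Fin s → ℂ) : linearForm c x = ∑ m, c m * x m := by
  simp [linearForm]

lemma norm_iteratedFDeriv_linear_le {E : Type*} [NormedAddCommGroup E] [NormedSpace ℂ E]
    (f : E →L[ℂ] ℂ) (d : ℕ) : ‖iteratedFDeriv ℂ d f 0‖ ≤ ‖f‖ := by
  rcases d with - | d
  · simp
  · rw [← norm_iteratedFDeriv_fderiv]
    have : fderiv ℂ f = fun _ => f := by
      funext x
      exact f.fderiv
    rw [this]
    rcases d with - | d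
    · simp
    · rw [iteratedFDeriv_const_of_ne (by omega)]
      simp

lemma range_eq_span_single {s : ℕ} {V : Type*} [AddCommGroup V] [Module ℂ V]
    (f : (Fin s → ℂ) →ₗ[ℂ] V) :
    LinearMap.range f = Submodule.span ℂ (Set.range fun j => f (Pi.single j 1)) := by
  rw [LinearMap.range_eq_map, ← (Pi.basisFun ℂ (Fin s)).span_eq, Submodule.map_span,
    ← Set.range_comp]
  congr 2
  funext j
  simp

lemma derivAtZero_transpose {s n : ℕ} {M : (Fin s → ℂ) → Matrix (Fin n) (Fin n) ℂ}
    (hM : IsSkewGerm M) (v : Fin s → ℂ) : (derivAtZero M v).transpose = -derivAtZero M v := by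
  ext i j
  have hev : (fun x => M x j i) =ᶠ[𝓝 0] fun x => -M x i j :=
    hM.2.mono fun x hx => congrFun (congrFun hx i) j
  change fderiv ℂ (fun x => M x j i) 0 _ = -fderiv ℂ (fun x => M x i j) 0 _
  rw [hev.fderiv_eq, fderiv_fun_neg]
  rfl

/-- If a germ vanishing at `0` is simple, the images of the linear maps close to its derivative
form finitely many classes up to congruence: it suffices to perturb the germ by linear terms. -/
lemma IsSkSimple.exists_finite_congruence {s n : ℕ}
    {M : (Fin s → ℂ) → Matrix (Fin n) (Fin n) ℂ} (hM : IsSkewGerm M) (hM0 : M 0 = 0)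
    (hsimple : IsSkSimple M) :
    ∃ S : Set (Fin s → Matrix (Fin n) (Fin n) ℂ), S.Finite ∧
      ∀ᶠ T in 𝓝 (fun j => derivAtZero M (Pi.single j 1)), (∀ j, (T j).transpose = -T j) →
        ∃ D ∈ S, ∃ h, IsUnit h ∧ Submodule.span ℂ (Set.range T) =
          (Submodule.span ℂ (Set.range D)).map (congruence h) := by
  obtain ⟨l, ε, F, hε, hF, hfin⟩ := hsimple
  set T₀ : Fin s → Matrix (Fin n) (Fin n) ℂ := fun j => derivAtZero M (Pi.single j 1) with hT₀
  refine ⟨(fun M₀ j => derivAtZero M₀ (Pi.single j 1)) '' F, hF.image _, ?_⟩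
  -- Adding a linear term with small coefficients changes only the first derivatives, and by little.
  have hsmall : ∀ᶠ T in 𝓝 T₀, ∀ i j, ‖linearForm fun m => (T m - T₀ m) i j‖ < ε := by
    refine eventually_all.2 fun i => eventually_all.2 fun j => ?_
    have hc : Continuous fun T : Fin s → Matrix (Fin n) (Fin n) ℂ =>
        ‖linearForm fun m => (T m - T₀ m) i j‖ := by
      unfold linearForm
      refine (continuous_finsetSum _ fun m _ => ?_).norm
      have hm : Continuous fun T : Fin s → Matrix (Fin n) (Fin n) ℂ => T m := continuous_apply m
      have hm' : Continuous fun T : Fin s → Matrix (Fin n) (Fin n) ℂ => (T m - T₀ m) i j :=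
        (hm.sub continuous_const).matrix_elem i j
      exact hm'.smul continuous_const
    refine hc.continuousAt.eventually_lt continuousAt_const ?_
    have h0 : (linearForm fun m => (T₀ m - T₀ m) i j) = 0 := by
      ext x
      simp [linearForm_apply]
    rwa [h0, norm_zero]
  have hT₀skew : ∀ m, (T₀ m).transpose = -T₀ m := fun m => derivAtZero_transpose hM _
  filter_upwards [hsmall] with T hT hTskew
  let M' : (Fin s → ℂ) → Matrix (Fin n) (Fin n) ℂ := fun x =>
    M x + Matrix.of fun i j => linearForm (fun m => (T m - T₀ m) i j) x
  have hM'an : ∀ i j, AnalyticAt ℂ (fun x => M' x i j) 0 := fun i j =>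
    (hM.1 i j).fun_add (ContinuousLinearMap.analyticAt _ _)
  have hM'skew : IsSkewGerm M' := by
    refine ⟨hM'an, hM.2.mono fun x hx => ?_⟩
    ext i j
    have h₁ : M x j i = -M x i j := congrFun (congrFun hx i) j
    have h₂ : ∀ m, (T m - T₀ m) j i = -(T m - T₀ m) i j := by
      intro m
      have h₃ : T m j i = -T m i j := congrFun (congrFun (hTskew m) i) j
      have h₄ : T₀ m j i = -T₀ m i j := congrFun (congrFun (hT₀skew m) i) j
      rw [Matrix.sub_apply, Matrix.sub_apply, h₃, h₄]; ring
    simp only [M', Matrix.transpose_apply, Matrix.add_apply, Matrix.neg_apply, Matrix.of_apply,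
      linearForm_apply, h₁, h₂, neg_mul, Finset.sum_neg_distrib]
    ring
  have hclose : JetClose l ε M M' := by
    intro d _ i j
    have : (fun x => M' x i j) = (fun x => M x i j) +
        (linearForm fun m => (T m - T₀ m) i j : (Fin s → ℂ) → ℂ) := rfl
    rw [this, iteratedFDeriv_add_apply (hM.1 i j).contDiffAt
      (ContinuousLinearMap.contDiff _).contDiffAt, add_sub_cancel_left]
    exact (norm_iteratedFDeriv_linear_le _ d).trans_lt (hT i j)
  have hM'0 : M' 0 = 0 := by
    ext i j
    simp [M', hM0, linearForm_apply]
  have hderiv : ∀ m, derivAtZero M' (Pi.single m 1) = T m := by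
    intro m
    ext i j
    have h₁ : HasFDerivAt (fun x => M' x i j) (fderiv ℂ (fun x => M x i j) 0 +
        linearForm fun m => (T m - T₀ m) i j) 0 :=
      (hM.1 i j).differentiableAt.hasFDerivAt.fun_add (ContinuousLinearMap.hasFDerivAt _)
    change fderiv ℂ (fun x => M' x i j) 0 (Pi.single m 1) = _
    rw [h₁.fderiv, add_apply, linearForm_apply]
    simp only [Pi.single_apply, mul_ite, mul_one, mul_zero, Finset.sum_ite_eq', Finset.mem_univ,
      if_true, Matrix.sub_apply]
    change T₀ m i j + (T m i j - T₀ m i j) = T m i j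
    ring
  obtain ⟨M₀, hM₀, hequiv⟩ := hfin M' hM'skew hclose
  obtain ⟨a, ha, hrange⟩ := exists_derivAtZero_eq_congruence hM'an hM'0 hequiv
  refine ⟨_, ⟨M₀, hM₀, rfl⟩, a, ha, ?_⟩
  rw [range_eq_span_single, range_eq_span_single] at hrange
  simpa only [hderiv] using hrange

/-! ### Moduli of spaces of matrices and of their annihilators -/

lemma exists_span_range_eq {V : Type*} [AddCommGroup V] [Module ℂ V] [FiniteDimensional ℂ V]
    (W : Submodule ℂ V) {ρ : ℕ} (hW : Module.finrank ℂ W ≤ ρ) :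
    ∃ B : Fin ρ → V, Submodule.span ℂ (Set.range B) = W := by
  let b := Module.finBasis ℂ W
  refine ⟨fun j => if h : (j : ℕ) < Module.finrank ℂ W then (b ⟨j, h⟩ : V) else 0,
    le_antisymm (Submodule.span_le.2 ?_) ?_⟩
  · rintro _ ⟨j, rfl⟩
    dsimp only
    split_ifs
    · exact Subtype.coe_prop _
    · exact W.zero_mem
  · have hb : W = Submodule.span ℂ (Set.range fun i => (b i : V)) := by
      have h := congrArg (Submodule.map W.subtype) b.span_eq
      rw [Submodule.map_span, ← Set.range_comp, Submodule.map_top, Submodule.range_subtype] at h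
      exact h.symm
    conv_lhs => rw [hb]
    refine Submodule.span_mono ?_
    rintro _ ⟨i, rfl⟩
    refine ⟨⟨i, i.2.trans_le hW⟩, ?_⟩
    simp

lemma finrank_span_range_comp {V W ι : Type*} [AddCommGroup V] [Module ℂ V] [AddCommGroup W]
    [Module ℂ W] {f : V →ₗ[ℂ] W} (hf : Function.Injective f) (t : ι → V) :
    Module.finrank ℂ (Submodule.span ℂ (Set.range fun m => f (t m))) =
      Module.finrank ℂ (Submodule.span ℂ (Set.range t)) := by
  have : Submodule.span ℂ (Set.range fun m => f (t m)) =
      (Submodule.span ℂ (Set.range t)).map f := by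
    rw [Submodule.map_span, ← Set.range_comp]
    rfl
  rw [this]
  exact (Submodule.equivMapOfInjective f hf _).finrank_eq.symm

lemma finrank_ker_mulVecLin_add {s : ℕ} {I : Type*} [Fintype I] [DecidableEq I]
    (t : Fin s → I → ℂ) :
    Module.finrank ℂ (LinearMap.ker (Matrix.of t).mulVecLin) +
      Module.finrank ℂ (Submodule.span ℂ (Set.range t)) = Fintype.card I := by
  have h₁ := LinearMap.finrank_range_add_finrank_ker (Matrix.of t).mulVecLin
  have h₂ := (Matrix.of t).rank_eq_finrank_span_row
  rw [Module.finrank_fintype_fun_eq_card] at h₁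
  rw [Matrix.rank] at h₂
  have h₃ : Set.range (Matrix.of t).row = Set.range t := rfl
  rw [h₃] at h₂
  omega

/-- A linear map of rank at most `ρ` factors through a surjection `π` onto `ℂ^ρ`; the other factor is
its restriction along a section `σ` of `π`. -/
lemma exists_factorization {s ρ : ℕ} {V : Type*} [AddCommGroup V] [Module ℂ V]
    (L : (Fin s → ℂ) →ₗ[ℂ] V) (hr : Module.finrank ℂ (LinearMap.range L) ≤ ρ) (hρ : ρ ≤ s) :
    ∃ (π : (Fin s → ℂ) →ₗ[ℂ] (Fin ρ → ℂ)) (σ : (Fin ρ → ℂ) →ₗ[ℂ] (Fin s → ℂ)),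
      Function.Surjective π ∧ L ∘ₗ σ ∘ₗ π = L := by
  have hker : s - ρ ≤ Module.finrank ℂ (LinearMap.ker L) := by
    have := LinearMap.finrank_range_add_finrank_ker L
    rw [Module.finrank_fin_fun] at this
    omega
  obtain ⟨v, hv⟩ := exists_linearIndependent_of_le_finrank hker
  let K : Submodule ℂ (Fin s → ℂ) := Submodule.span ℂ (Set.range fun i => (v i : Fin s → ℂ))
  have hK : Module.finrank ℂ K = s - ρ := by
    have := finrank_span_eq_card (hv.map' (LinearMap.ker L).subtype (Submodule.ker_subtype _))
    rwa [Fintype.card_fin] at this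
  have hKL : K ≤ LinearMap.ker L := by
    refine Submodule.span_le.2 ?_
    rintro _ ⟨i, rfl⟩
    exact (v i).2
  have hquot : Module.finrank ℂ ((Fin s → ℂ) ⧸ K) = Module.finrank ℂ (Fin ρ → ℂ) := by
    have := K.finrank_quotient_add_finrank
    rw [Module.finrank_fin_fun] at this ⊢
    omega
  let e := LinearEquiv.ofFinrankEq _ _ hquot
  let π : (Fin s → ℂ) →ₗ[ℂ] (Fin ρ → ℂ) := e.toLinearMap ∘ₗ K.mkQ
  have hπ : Function.Surjective π := e.surjective.comp K.mkQ_surjective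
  obtain ⟨σ, hσ⟩ := π.exists_rightInverse_of_surjective (LinearMap.range_eq_top.2 hπ)
  refine ⟨π, σ, hπ, LinearMap.ext fun x => ?_⟩
  have h₁ : π (σ (π x)) = π x := LinearMap.congr_fun hσ (π x)
  have h₂ : K.mkQ (σ (π x)) = K.mkQ x := e.injective h₁
  have h₃ : σ (π x) - x ∈ K := (Submodule.Quotient.eq K).1 h₂
  have h₄ : L (σ (π x) - x) = 0 := hKL h₃
  rw [map_sub, sub_eq_zero] at h₄
  exact h₄

/-- A simple germ cannot be deformed to germs with derivatives of a rank `ρ` for which there are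
moduli of `ρ`-dimensional spaces of matrices. -/
lemma not_hasModuli_of_isSkSimple {s n ρ : ℕ} {M : (Fin s → ℂ) → Matrix (Fin n) (Fin n) ℂ}
    (hM : IsSkewGerm M) (hM0 : M 0 = 0) (hsimple : IsSkSimple M) (hr : rankAtZero M ≤ ρ)
    (hρ : ρ ≤ s) : ¬ HasModuli ρ n := by
  intro hmod
  obtain ⟨S, hS, hev⟩ := hsimple.exists_finite_congruence hM hM0
  set L := derivAtZero M
  obtain ⟨π, σ, hπ, hL⟩ := exists_factorization L hr hρ
  let c₀ : Fin ρ → SkewIndex n → ℂ := fun j => upperEntries n (L (σ (Pi.single j 1)))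
  let T : (Fin ρ → SkewIndex n → ℂ) → Fin s → Matrix (Fin n) (Fin n) ℂ := fun c m =>
    ∑ j, π (Pi.single m 1) j • skewMatrix n (c j)
  have hT₀ : T c₀ = fun m => L (Pi.single m 1) := by
    funext m
    conv_rhs => rw [← hL]
    simp only [T, c₀, skewMatrix_upperEntries (derivAtZero_transpose hM _), LinearMap.comp_apply, L]
    conv_rhs => rw [pi_eq_sum_univ' (π (Pi.single m 1))]
    simp only [map_sum, map_smul]
  have hTc : Continuous T := by
    refine continuous_pi fun m => continuous_finsetSum _ fun j _ => ?_
    have hj : Continuous fun c : Fin ρ → SkewIndex n → ℂ => c j := continuous_apply j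
    have hj' : Continuous fun c : Fin ρ → SkewIndex n → ℂ => skewMatrix n (c j) :=
      (continuous_skewMatrix n).comp hj
    exact hj'.const_smul (π (Pi.single m 1) j)
  have hspan : ∀ c, Submodule.span ℂ (Set.range (T c)) =
      Submodule.span ℂ (Set.range fun j => skewMatrix n (c j)) := by
    intro c
    let G := Fintype.linearCombination ℂ (fun j => skewMatrix n (c j))
    have h₁ := range_eq_span_single (G ∘ₗ π)
    have h₂ := range_eq_span_single G
    rw [LinearMap.range_comp_of_range_eq_top _ (LinearMap.range_eq_top.2 hπ), h₂] at h₁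
    have h₃ : (fun j => G (Pi.single j 1)) = fun j => skewMatrix n (c j) := by
      funext j
      simp [G, Fintype.linearCombination_apply_single]
    rw [h₃] at h₁
    rw [h₁]
    rfl
  choose B hB using fun D : Fin s → Matrix (Fin n) (Fin n) ℂ =>
    show ∃ B : Fin ρ → Matrix (Fin n) (Fin n) ℂ,
      Module.finrank ℂ (Submodule.span ℂ (Set.range D)) ≤ ρ →
        Submodule.span ℂ (Set.range B) = Submodule.span ℂ (Set.range D) from by
      by_cases h : Module.finrank ℂ (Submodule.span ℂ (Set.range D)) ≤ ρ
      · obtain ⟨B, hB⟩ := exists_span_range_eq _ h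
        exact ⟨B, fun _ => hB⟩
      · exact ⟨0, fun h' => absurd h' h⟩
  rw [← hT₀] at hev
  have hU := hTc.continuousAt.eventually hev
  obtain ⟨c, hcU, hc⟩ := hmod (B '' S) (hS.image B) c₀ _ hU
  obtain ⟨D, hD, h, hh, hDspan⟩ := hcU fun m => by
    simp only [T, Matrix.transpose_sum, Matrix.transpose_smul, skewMatrix_transpose, smul_neg,
      Finset.sum_neg_distrib]
  rw [hspan] at hDspan
  have hDρ : Module.finrank ℂ (Submodule.span ℂ (Set.range D)) ≤ ρ := by
    rw [(Submodule.equivMapOfInjective _ (congruence_injective hh) _).finrank_eq, ← hDspan]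
    exact (finrank_range_le_card _).trans (Fintype.card_fin ρ).le
  have hmem : ∀ j, ∃ g : Fin ρ → ℂ, skewMatrix n (c j) =
      h.transpose * (∑ l, g l • B D l) * h := by
    intro j
    have hj : skewMatrix n (c j) ∈ Submodule.span ℂ (Set.range fun j => skewMatrix n (c j)) :=
      Submodule.subset_span ⟨j, rfl⟩
    rw [hDspan, ← hB D hDρ] at hj
    obtain ⟨Y, hY, hYj⟩ := hj
    obtain ⟨g, rfl⟩ := (Submodule.mem_span_range_iff_exists_fun ℂ).1 hY
    exact ⟨g, by rw [← hYj, congruence_apply]⟩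
  choose g hg using hmem
  exact hc (B D) ⟨D, hD, rfl⟩ g h hh hg

/-- Moduli of pencils give, by passing to annihilators with respect to the trace form, moduli of
spaces of skew-symmetric matrices of codimension two. -/
lemma not_hasModuli_two_of_isSkSimple {s n : ℕ} {M : (Fin s → ℂ) → Matrix (Fin n) (Fin n) ℂ}
    (hM : IsSkewGerm M) (hM0 : M 0 = 0) (hsimple : IsSkSimple M)
    (hr : rankAtZero M + 2 = Fintype.card (SkewIndex n)) : ¬ HasModuli 2 n := by
  intro hmod
  obtain ⟨S, hS, hev⟩ := hsimple.exists_finite_congruence hM hM0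
  set L := derivAtZero M
  let t : Fin s → SkewIndex n → ℂ := fun m => upperEntries n (L (Pi.single m 1))
  have ht : ∀ m, skewMatrix n (t m) = L (Pi.single m 1) := fun m =>
    skewMatrix_upperEntries (derivAtZero_transpose hM _)
  have htrank : Module.finrank ℂ (Submodule.span ℂ (Set.range t)) = rankAtZero M := by
    have h := finrank_span_range_comp (skewMatrix_injective n) t
    rw [rankAtZero, range_eq_span_single, ← h, funext ht]
  have hker : Module.finrank ℂ (LinearMap.ker (Matrix.of t).mulVecLin) = 2 := by
    have := finrank_ker_mulVecLin_add t
    omega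
  -- A basis `b` of the annihilator, and a left inverse `Γ` of the matrix with columns `b`.
  obtain ⟨b', hb'⟩ := exists_linearIndependent_of_le_finrank hker.ge
  let b : Fin 2 → SkewIndex n → ℂ := fun i => b' i
  have hb : LinearIndependent ℂ b :=
    hb'.map' (LinearMap.ker (Matrix.of t).mulVecLin).subtype (Submodule.ker_subtype _)
  have htb : ∀ m i, t m ⬝ᵥ b i = 0 := fun m i => congrFun (b' i).2 m
  obtain ⟨G, hG⟩ := (Fintype.linearCombination ℂ b).exists_leftInverse_of_injective
    (LinearMap.ker_eq_bot.2 hb.fintypeLinearCombination_injective)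
  let Γ := LinearMap.toMatrix' G
  have hΓ : ∀ i, Γ.mulVec (b i) = Pi.single i 1 := by
    intro i
    have h := LinearMap.congr_fun hG (Pi.single i 1)
    rw [LinearMap.comp_apply, Fintype.linearCombination_apply_single, one_smul] at h
    rw [LinearMap.toMatrix'_mulVec, h]
    rfl
  -- A matrix close to the identity which maps `b` to a pair `c` close to `b`.
  let Ψ : (Fin 2 → SkewIndex n → ℂ) → Matrix (SkewIndex n) (SkewIndex n) ℂ := fun c =>
    1 + (Matrix.of fun p i => c i p - b i p) * Γ
  have hΨb : ∀ c i, (Ψ c).mulVec (b i) = c i := by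
    intro c i
    simp only [Ψ, Matrix.add_mulVec, Matrix.one_mulVec, ← Matrix.mulVec_mulVec, hΓ,
      Matrix.mulVec_single_one]
    ext p
    simp
  have hΨc : Continuous Ψ := by
    refine continuous_const.add (Continuous.matrix_mul (continuous_matrix fun p i => ?_)
      continuous_const)
    exact (continuous_apply_apply i p).sub continuous_const
  have hΨ1 : Ψ b = 1 := by
    have : (Matrix.of fun (p : SkewIndex n) (i : Fin 2) => b i p - b i p) = 0 := by
      ext p i
      simp
    simp only [Ψ, this, Matrix.zero_mul, add_zero]
  -- The transpose of the adjugate of `Ψ c` maps the annihilator of `b` to the annihilator of `c`; the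
  -- adjugate is used instead of the inverse for its continuity everywhere.
  let T : (Fin 2 → SkewIndex n → ℂ) → Fin s → Matrix (Fin n) (Fin n) ℂ := fun c m =>
    skewMatrix n (Matrix.vecMul (t m) (Ψ c).adjugate)
  have hTc : Continuous T := by
    refine continuous_pi fun m => (continuous_skewMatrix n).comp ?_
    exact Continuous.matrix_vecMul continuous_const hΨc.matrix_adjugate
  have hTb : T b = fun m => L (Pi.single m 1) := by
    funext m
    simp only [T, hΨ1, Matrix.adjugate_one, Matrix.vecMul_one, ht]
  have hTann : ∀ c m i, (T c m * skewMatrix n (c i)).trace = 0 := by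
    intro c m i
    rw [trace_skewMatrix_mul, ← hΨb c i, ← Matrix.dotProduct_mulVec, Matrix.mulVec_mulVec,
      Matrix.adjugate_mul, Matrix.smul_mulVec, Matrix.one_mulVec, dotProduct_smul, htb, smul_zero,
      mul_zero]
  have hTrank : ∀ c, (Ψ c).det ≠ 0 →
      Module.finrank ℂ (Submodule.span ℂ (Set.range (T c))) = rankAtZero M := by
    intro c hc
    have hinj : Function.Injective (Matrix.vecMulLinear (Ψ c).adjugate) := by
      rw [Matrix.coe_vecMulLinear, Matrix.vecMul_injective_iff_isUnit,
        Matrix.isUnit_iff_isUnit_det, Matrix.det_adjugate]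
      exact (pow_ne_zero _ hc).isUnit
    rw [← htrank, ← finrank_span_range_comp hinj t, ← finrank_span_range_comp
      (skewMatrix_injective n)]
    rfl
  choose B hB using fun D : Fin s → SkewIndex n → ℂ =>
    show ∃ B : Fin 2 → SkewIndex n → ℂ,
      Module.finrank ℂ (LinearMap.ker (Matrix.of D).mulVecLin) ≤ 2 →
        Submodule.span ℂ (Set.range B) = LinearMap.ker (Matrix.of D).mulVecLin from by
      by_cases h : Module.finrank ℂ (LinearMap.ker (Matrix.of D).mulVecLin) ≤ 2
      · obtain ⟨B, hB⟩ := exists_span_range_eq _ h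
        exact ⟨B, fun _ => hB⟩
      · exact ⟨0, fun h' => absurd h' h⟩
  let d : (Fin s → Matrix (Fin n) (Fin n) ℂ) → Fin s → SkewIndex n → ℂ := fun D m =>
    upperEntries n (D m)
  rw [← hTb] at hev
  have hdet : ∀ᶠ c in 𝓝 b, (Ψ c).det ≠ 0 := by
    refine hΨc.matrix_det.continuousAt.eventually_ne ?_
    rw [hΨ1, Matrix.det_one]
    exact one_ne_zero
  have hU := (hTc.continuousAt.eventually hev).and hdet
  obtain ⟨c, ⟨hcU, hcdet⟩, hc⟩ :=
    hmod ((fun D l => skewMatrix n (B (d D) l)) '' S) (hS.image _) b _ hU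
  obtain ⟨D, hD, h, hh, hDspan⟩ := hcU fun m => skewMatrix_transpose _
  have hhdet := (Matrix.isUnit_iff_isUnit_det h).1 hh
  have hhtdet : IsUnit h.transpose.det := by rwa [Matrix.det_transpose]
  -- Every element of the span of `T c` is skew-symmetric and orthogonal to `c 0` and `c 1`.
  have hspan : ∀ X ∈ Submodule.span ℂ (Set.range (T c)), X.transpose = -X ∧
      ∀ i, (X * skewMatrix n (c i)).trace = 0 := by
    intro X hX
    obtain ⟨g, rfl⟩ := (Submodule.mem_span_range_iff_exists_fun ℂ).1 hX
    constructor
    · simp only [T, Matrix.transpose_sum, Matrix.transpose_smul, skewMatrix_transpose, smul_neg,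
        Finset.sum_neg_distrib]
    · intro i
      simp only [Finset.sum_mul, Matrix.smul_mul, Matrix.trace_sum, Matrix.trace_smul, hTann,
        smul_zero, Finset.sum_const_zero]
  have hDmem : ∀ m, h.transpose * D m * h ∈ Submodule.span ℂ (Set.range (T c)) := by
    intro m
    rw [hDspan, ← congruence_apply]
    exact Submodule.mem_map_of_mem (Submodule.subset_span ⟨m, rfl⟩)
  have hDskew : ∀ m, (D m).transpose = -D m := by
    intro m
    refine congruence_injective hh ?_
    have := (hspan _ (hDmem m)).1
    rw [Matrix.transpose_mul, Matrix.transpose_mul, Matrix.transpose_transpose, ← mul_assoc] at this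
    rw [map_neg, congruence_apply, congruence_apply, this]
  have hdD : ∀ m, skewMatrix n (d D m) = D m := fun m => skewMatrix_upperEntries (hDskew m)
  have hdker : Module.finrank ℂ (LinearMap.ker (Matrix.of (d D)).mulVecLin) ≤ 2 := by
    have h₁ := finrank_ker_mulVecLin_add (d D)
    rw [← finrank_span_range_comp (skewMatrix_injective n) (d D)] at h₁
    rw [funext hdD] at h₁
    have h₂ := hTrank c hcdet
    rw [hDspan, ← (Submodule.equivMapOfInjective _ (congruence_injective hh) _).finrank_eq] at h₂
    rw [h₂] at h₁
    omega
  have hmem : ∀ j, ∃ g : Fin 2 → ℂ, skewMatrix n (c j) =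
      h⁻¹.transpose.transpose * (∑ l, g l • skewMatrix n (B (d D) l)) * h⁻¹.transpose := by
    intro j
    have hYskew : (h * skewMatrix n (c j) * h.transpose).transpose =
        -(h * skewMatrix n (c j) * h.transpose) := by
      rw [Matrix.transpose_mul, Matrix.transpose_mul, Matrix.transpose_transpose,
        skewMatrix_transpose, ← mul_assoc, mul_neg, neg_mul]
    have hY := skewMatrix_upperEntries hYskew
    set y := upperEntries n (h * skewMatrix n (c j) * h.transpose)
    have hyker : y ∈ LinearMap.ker (Matrix.of (d D)).mulVecLin := by
      rw [LinearMap.mem_ker]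
      ext m
      have h₁ := (hspan _ (hDmem m)).2 j
      rw [mul_assoc, mul_assoc, Matrix.trace_mul_comm, mul_assoc, mul_assoc, ← mul_assoc h, ← hY,
        ← hdD m, trace_skewMatrix_mul] at h₁
      simpa [Matrix.mulVec] using h₁
    rw [← hB _ hdker] at hyker
    obtain ⟨g, hg⟩ := (Submodule.mem_span_range_iff_exists_fun ℂ).1 hyker
    refine ⟨g, ?_⟩
    simp only [← map_smul, ← map_sum]
    rw [hg, hY, Matrix.transpose_transpose, Matrix.transpose_nonsing_inv]
    simp only [mul_assoc]
    rw [Matrix.mul_nonsing_inv _ hhtdet, mul_one, Matrix.nonsing_inv_mul_cancel_left _ _ hhdet]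
  choose g hg using hmem
  refine hc _ ⟨D, hD, rfl⟩ g h⁻¹.transpose ?_ hg
  rw [Matrix.isUnit_iff_isUnit_det, Matrix.det_transpose]
  exact Matrix.isUnit_nonsing_inv_det _ hhdet

/-! ### Simple germs -/

lemma rankAtZero_le {s n : ℕ} (M : (Fin s → ℂ) → Matrix (Fin n) (Fin n) ℂ) : rankAtZero M ≤ s := by
  have := LinearMap.finrank_range_le (derivAtZero M)
  rwa [Module.finrank_fin_fun] at this

lemma rankAtZero_le_card {s n : ℕ} {M : (Fin s → ℂ) → Matrix (Fin n) (Fin n) ℂ}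
    (hM : IsSkewGerm M) : rankAtZero M ≤ Fintype.card (SkewIndex n) := by
  have hle : LinearMap.range (derivAtZero M) ≤ LinearMap.range (skewMatrix n) := by
    rintro _ ⟨v, rfl⟩
    exact ⟨_, skewMatrix_upperEntries (derivAtZero_transpose hM v)⟩
  have := (Submodule.finrank_mono hle).trans (LinearMap.finrank_range_le (skewMatrix n))
  rwa [Module.finrank_fintype_fun_eq_card] at this

theorem mainTheorem3 (s k r N : ℕ) (hs : 1 ≤ s) (hk : 2 ≤ k) (hN : N = k * (2 * k - 1))
    (M : (Fin s → ℂ) → Matrix (Fin (2 * k)) (Fin (2 * k)) ℂ)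
    (hM : IsSkewGerm M) (hM0 : M 0 = 0) (hr : rankAtZero M = r) (hsimple : IsSkSimple M) :
    (s = 1 ∧ (r = 0 ∨ r = 1)) ∨
    (3 ≤ k ∧ N - 1 ≤ s ∧ (r = N ∨ r = N - 1)) ∨
    (k = 3 ∧ s = 2 ∧ r ≤ 2) ∨
    (k = 3 ∧ r = 13 ∧ 13 ≤ s) ∨
    (k = 2 ∧ 2 ≤ s) := by
  have hrs : r ≤ s := hr ▸ rankAtZero_le M
  have hrN : r ≤ N := by
    rw [← hr, hN, ← card_skewIndex]
    exact rankAtZero_le_card hM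
  have hexclude : ∀ ρ, r ≤ ρ → ρ ≤ s → ¬ HasModuli ρ (2 * k) := fun ρ h₁ h₂ =>
    not_hasModuli_of_isSkSimple hM hM0 hsimple (hr.le.trans h₁) h₂
  have hexclude' : r + 2 = N → ¬ HasModuli 2 (2 * k) := fun h =>
    not_hasModuli_two_of_isSkSimple hM hM0 hsimple (by rw [hr, h, hN, card_skewIndex])
  by_contra hcon
  have hs2 : 2 ≤ s := by omega
  have hk3 : 3 ≤ k := by omega
  have hN15 : 15 ≤ N := by
    rw [hN]
    exact Nat.mul_le_mul hk3 (show 5 ≤ 2 * k - 1 by omega)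
  have hrN2 : r + 2 ≤ N := by omega
  -- Ranks below `3` are raised to `3` by a deformation, if the dimension of the source allows it.
  have hmiddle : ¬ (3 ≤ s ∧ r + 3 ≤ N) := by
    rintro ⟨hs3, hr3⟩
    exact hexclude (max r 3) (le_max_left _ _) (max_le hrs hs3)
      (hasModuli_of_three_le hk3 (le_max_right _ _) (by omega))
  rcases hk3.eq_or_lt with rfl | hk4
  · omega
  -- What remains is `s = 2`, where pencils are deformed, or `r = N - 2`.
  · have hmod := hasModuli_two hk4
    by_cases hs3 : 3 ≤ s
    · exact hexclude' (by omega) hmod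
    · exact hexclude 2 (by omega) hs2 hmod
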